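/- Let $\lambda_0\ge 0$, $L\ge 0$, $R\ge 0$. Let the germs of the obstacles form a homogeneous Poisson point process in $\mathbb R^2$ of intensity $\lambda_0$. The obstacle with germ $(\rho,\beta)$ (polar coordinates) is the line segment of length $L$ with midpoint $(\rho,\beta)$ and orientation $\beta+\pi/2$, so that it faces the origin $\mathbf o$. A point $\mathbf p$ is visible to $\mathbf o$ if no obstacle meets the line segment from $\mathbf o$ to $\mathbf p$. Let $A_v$ be the visible area, i.e. the area of the set of points of the disc of radius $R$ around $\mathbf o$ that are visible to $\mathbf o$. For a point $\mathbf p=(r,\phi)$ in polar coordinates, let $$S_V(\mathbf p)=\Big\{(\rho,\beta):\ |\beta-\phi|<\tfrac{\pi}{2},\ 0\le\rho\tan|\beta-\phi|\le \tfrac L2,\ 0\le\rho\sec|\beta-\phi|\le r\Big\},$$ a set of points of the plane in polar coordinates, where $\rho\ge 0$ and angles are taken modulo $2\pi$, and let $\nu_2$ denote area. Then $A_v$ is integrable, for every direction $\phi$ $$\mathbb E[A_v]=2\pi\int_0^R e^{-\lambda_0\,\nu_2(S_V((r,\phi)))}\,r\,dr,$$ and for every $\mathbf p=(r,\phi)$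 with $0\le r\le R$ $$\nu_2(S_V(\mathbf p))=2\int_0^r\rho\,\min\Big(\arctan\Big(\frac{L}{2\rho}\Big),\arccos\Big(\frac{\rho}{r}\Big)\Big)\,d\rho .$$ -/

import Mathlib

open MeasureTheory ProbabilityTheory

open scoped NNReal

/-- The plane `ℝ²` is modelled by `ℂ` with its Euclidean norm and Lebesgue area measure `volume`;
the point with polar coordinates `(r, φ)` is `r e^{iφ}`. -/
noncomputable def polarPoint (r φ : ℝ) : ℂ :=
  (r : ℂ) * Complex.exp ((φ : ℂ) * Complex.I)

/-- The random set `Φ` of points of the plane is a homogeneous Poisson point process of intensity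
`lam0`: its realizations are locally finite, the number of points in a bounded Borel set `B` is a
Poisson random variable with mean `lam0 * area B`, and the numbers of points in finitely many
pairwise disjoint bounded Borel sets are independent. -/
structure IsHomogeneousPPP {Ω : Type*} [MeasurableSpace Ω] (μ : Measure Ω) (lam0 : ℝ≥0)
    (Φ : Ω → Set ℂ) : Prop where
  locallyFinite : ∀ (ω : Ω) (B : Set ℂ), Bornology.IsBounded B → (Φ ω ∩ B).Finite
  measurable_count : ∀ B : Set ℂ, MeasurableSet B → Bornology.IsBounded B →
    Measurable fun ω => (Φ ω ∩ B).ncard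
  map_count : ∀ B : Set ℂ, MeasurableSet B → Bornology.IsBounded B →
    μ.map (fun ω => (Φ ω ∩ B).ncard) = poissonMeasure (lam0 * (volume B).toNNReal)
  indep_count : ∀ (n : ℕ) (B : Fin n → Set ℂ), (∀ i, MeasurableSet (B i)) →
    (∀ i, Bornology.IsBounded (B i)) → (∀ i j, i ≠ j → Disjoint (B i) (B j)) →
    iIndepFun (fun i ω => (Φ ω ∩ B i).ncard) μ

/-- The obstacle with germ `q`, facing the origin: the closed line segment of length `L` with
midpoint `q` and orientation `arg q + π / 2`. -/
noncomputable def facingObstacle (L : ℝ) (q : ℂ) : Set ℂ :=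
  segment ℝ (q - polarPoint (L / 2) (Complex.arg q + Real.pi / 2))
    (q + polarPoint (L / 2) (Complex.arg q + Real.pi / 2))

/-- The point `p` is visible to the origin when no obstacle with germ in `G` meets the
line-of-sight path from the origin to `p`. -/
def VisibleFromOrigin (L : ℝ) (G : Set ℂ) (p : ℂ) : Prop :=
  ∀ q ∈ G, Disjoint (segment ℝ 0 p) (facingObstacle L q)

/-- The visible region in the disc of radius `R` around the origin. -/
def visibleRegion (L R : ℝ) (G : Set ℂ) : Set ℂ :=
  {p : ℂ | p ∈ Metric.closedBall (0 : ℂ) R ∧ VisibleFromOrigin L G p}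

/-- The visible area. -/
noncomputable def visibleArea (L R : ℝ) (G : Set ℂ) : ℝ :=
  (volume (visibleRegion L R G)).toReal

/-- The blocking region `S_V` of the point with polar coordinates `(r, φ)`. Polar angles `β` are
taken modulo `2π`: any representative may be used, and the one with `|β - φ| < π / 2`
is where the tangent and the secant are defined and nonnegative. -/
noncomputable def blockingRegion (L r φ : ℝ) : Set ℂ :=
  {q : ℂ | ∃ ρ β : ℝ, 0 ≤ ρ ∧ q = polarPoint ρ β ∧ |β - φ| < Real.pi / 2 ∧
    (0 ≤ ρ * Real.tan |β - φ| ∧ ρ * Real.tan |β - φ| ≤ L / 2) ∧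
    (0 ≤ ρ * (1 / Real.cos |β - φ|) ∧ ρ * (1 / Real.cos |β - φ|) ≤ r)}

/-! By Tonelli, the mean visible area is the integral over the disc of the probability that `p` is
visible. This event says that no germ lies in the bounded closed set of germs blocking `p`, so its
probability is the Poisson void probability. Rotation invariance makes it a function of |p| alone,
and polar coordinates give both formulas.

The bridge is `shadowGerms`. With ρ = |q|, r = |p| and δ the angle from p to q, its conditions are ρ
≤ r cos δ and ρ|sin δ| ≤ (L/2) cos δ, multiplied by ρ and ρr. Free of angles, they are closed
conditions in (p, q); they match both actual blocking (`disjoint_facingObstacle_iff`) and `S_V`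
(`blockingRegion_eq_shadowGerms`). Tonelli also needs joint measurability of visibility
(`IsHomogeneousPPP.measurableSet_visible`), to be extracted from counts in fixed sets. -/

/-- The germs whose facing obstacle of length `L` meets the line of sight from the origin to `p`. -/
def shadowGerms (L : ℝ) (p : ℂ) : Set ℂ :=
  {q : ℂ | ‖q‖ ^ 2 ≤ (q * star p).re ∧ ‖q‖ * |(q * star p).im| ≤ L / 2 * (q * star p).re}

/-! ### Polar coordinates and the blocking region -/

lemma norm_polarPoint {r : ℝ} (hr : 0 ≤ r) (φ : ℝ) : ‖polarPoint r φ‖ = r := by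
  simp [polarPoint, Complex.norm_exp_ofReal_mul_I, abs_of_nonneg hr]

lemma polarPoint_eq_cos_add_sin (r φ : ℝ) :
    polarPoint r φ = r * (Real.cos φ + Real.sin φ * Complex.I) := by
  rw [polarPoint, Complex.exp_mul_I, Complex.ofReal_cos, Complex.ofReal_sin]

lemma polarPoint_norm_arg (q : ℂ) : polarPoint ‖q‖ q.arg = q :=
  Complex.norm_mul_exp_arg_mul_I q

lemma polarPoint_mul_star (ρ β r φ : ℝ) :
    polarPoint ρ β * star (polarPoint r φ) = polarPoint (ρ * r) (β - φ) := by
  apply Complex.ext <;>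
    simp [polarPoint_eq_cos_add_sin, Real.cos_sub, Real.sin_sub] <;> ring

lemma polarPoint_re (r φ : ℝ) : (polarPoint r φ).re = r * Real.cos φ := by
  simp [polarPoint_eq_cos_add_sin, -Complex.ofReal_cos, -Complex.ofReal_sin]

lemma polarPoint_im (r φ : ℝ) : (polarPoint r φ).im = r * Real.sin φ := by
  simp [polarPoint_eq_cos_add_sin, -Complex.ofReal_cos, -Complex.ofReal_sin]

lemma polarPoint_mem_shadowGerms_iff {L ρ β r φ : ℝ} (hρ : 0 < ρ) (hr : 0 < r) :
    polarPoint ρ β ∈ shadowGerms L (polarPoint r φ) ↔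
      ρ ≤ r * Real.cos (β - φ) ∧ ρ * |Real.sin (β - φ)| ≤ L / 2 * Real.cos (β - φ) := by
  simp only [shadowGerms, Set.mem_ofPred_eq, polarPoint_mul_star, polarPoint_re, polarPoint_im,
    norm_polarPoint hρ.le, abs_mul, abs_of_pos hρ, abs_of_pos hr]
  rw [show ρ ^ 2 = ρ * ρ by ring, show ρ * r * Real.cos (β - φ) = ρ * (r * Real.cos (β - φ)) by ring,
    mul_le_mul_iff_right₀ hρ,
    show ρ * (ρ * r * |Real.sin (β - φ)|) = (ρ * r) * (ρ * |Real.sin (β - φ)|) by ring,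
    show L / 2 * (ρ * (r * Real.cos (β - φ))) = (ρ * r) * (L / 2 * Real.cos (β - φ)) by ring,
    mul_le_mul_iff_right₀ (mul_pos hρ hr)]

lemma zero_mem_shadowGerms (L : ℝ) (p : ℂ) : (0 : ℂ) ∈ shadowGerms L p := by
  simp [shadowGerms]

lemma norm_le_of_mem_shadowGerms {L : ℝ} {p q : ℂ} (hq : q ∈ shadowGerms L p) : ‖q‖ ≤ ‖p‖ := by
  have h1 : ‖q‖ ^ 2 ≤ ‖q‖ * ‖p‖ :=
    hq.1.trans ((Complex.re_le_norm _).trans (by simp))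
  rcases (norm_nonneg q).eq_or_lt with h | h
  · rw [← h]; exact norm_nonneg p
  · rw [pow_two] at h1
    exact le_of_mul_le_mul_left h1 h

lemma tan_sec_bounds_iff {L r φ ρ β : ℝ} (hβ : |β - φ| < Real.pi / 2) :
    ((0 ≤ ρ * Real.tan |β - φ| ∧ ρ * Real.tan |β - φ| ≤ L / 2) ∧
      (0 ≤ ρ * (1 / Real.cos |β - φ|) ∧ ρ * (1 / Real.cos |β - φ|) ≤ r)) ↔
    (0 ≤ ρ * |Real.sin (β - φ)| ∧ 0 ≤ ρ) ∧
      ρ ≤ r * Real.cos (β - φ) ∧ ρ * |Real.sin (β - φ)| ≤ L / 2 * Real.cos (β - φ) := by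
  have hc : 0 < Real.cos (β - φ) := Real.cos_pos_of_mem_Ioo (abs_lt.mp hβ)
  have hs : |Real.sin (β - φ)| = Real.sin |β - φ| :=
    Real.abs_sin_eq_sin_abs_of_abs_le_pi (by linarith [Real.pi_pos])
  rw [Real.tan_eq_sin_div_cos, ← hs, Real.cos_abs, ← mul_div_assoc, div_le_iff₀ hc,
    mul_one_div, div_le_iff₀ hc, le_div_iff₀ hc, le_div_iff₀ hc, zero_mul]
  tauto

lemma blockingRegion_eq_shadowGerms {L r : ℝ} (hL : 0 ≤ L) (hr : 0 ≤ r) (φ : ℝ) :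
    blockingRegion L r φ = shadowGerms L (polarPoint r φ) := by
  ext q
  constructor
  · rintro ⟨ρ, β, hρ, rfl, hβ, h⟩
    obtain ⟨-, h1, h2⟩ := (tan_sec_bounds_iff hβ).mp h
    rcases hρ.eq_or_lt with rfl | hρ
    · simpa [polarPoint] using zero_mem_shadowGerms L _
    · have hr : 0 < r := pos_of_mul_pos_left (hρ.trans_le h1)
        (Real.cos_pos_of_mem_Ioo (abs_lt.mp hβ)).le
      exact (polarPoint_mem_shadowGerms_iff hρ hr).mpr ⟨h1, h2⟩
  · intro hq
    rcases eq_or_ne q 0 with rfl | hq0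
    · exact ⟨0, φ, le_rfl, by simp [polarPoint], by simp [Real.pi_pos], by simp; linarith,
        by simpa using hr⟩
    · have hn : 0 < ‖q‖ := norm_pos_iff.mpr hq0
      have hr : 0 < r := by
        have := norm_le_of_mem_shadowGerms hq
        rw [norm_polarPoint hr] at this
        linarith
      -- `q.arg` may be off from φ by a full turn. Rotating by -φ before taking the argument yields
      -- a representative near φ.
      set w := q * star (polarPoint 1 φ) with hw
      have hnw : ‖w‖ = ‖q‖ := by rw [hw, norm_mul, norm_star, norm_polarPoint zero_le_one, mul_one]
      have hqw : q = polarPoint ‖q‖ (φ + w.arg) := by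
        have h1 : polarPoint ‖q‖ (φ + w.arg) = polarPoint 1 φ * polarPoint ‖w‖ w.arg := by
          rw [hnw]; simp only [polarPoint]; push_cast; rw [add_mul, Complex.exp_add]; ring
        have h2 : polarPoint 1 φ * star (polarPoint 1 φ) = 1 := by
          rw [polarPoint_mul_star]; simp [polarPoint]
        rw [h1, polarPoint_norm_arg, hw, mul_left_comm, h2, mul_one]
      have hwre : 0 < w.re := by
        have h1 := hq.1
        have : star (polarPoint r φ) = r * star (polarPoint 1 φ) := by
          simp [polarPoint]
        rw [this, mul_left_comm, Complex.re_ofReal_mul] at h1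
        exact pos_of_mul_pos_right (lt_of_lt_of_le (by positivity) h1) hr.le
      have harg : |φ + w.arg - φ| < Real.pi / 2 := by
        rw [add_sub_cancel_left]
        exact Complex.abs_arg_lt_pi_div_two_iff.mpr (Or.inl hwre)
      refine ⟨‖q‖, φ + w.arg, hn.le, hqw, harg, (tan_sec_bounds_iff harg).mpr
        ⟨⟨by positivity, hn.le⟩, ?_⟩⟩
      rw [hqw] at hq
      exact (polarPoint_mem_shadowGerms_iff hn hr).mp hq

/-! ### Obstacles crossing the line of sight -/

lemma mem_facingObstacle_iff {L : ℝ} (hL : 0 ≤ L) (q z : ℂ) :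
    z ∈ facingObstacle L q ↔
      ∃ τ : ℝ, |τ| ≤ L / 2 ∧ z = (‖q‖ + τ * Complex.I) * polarPoint 1 q.arg := by
  have hv : polarPoint (L / 2) (q.arg + Real.pi / 2) =
      (L / 2 : ℝ) * Complex.I * polarPoint 1 q.arg := by
    apply Complex.ext <;> simp [polarPoint_eq_cos_add_sin, Real.cos_add_pi_div_two,
      Real.sin_add_pi_div_two]
  have hq : q = ‖q‖ * polarPoint 1 q.arg := by
    conv_lhs => rw [← polarPoint_norm_arg q]
    simp [polarPoint]
  rw [facingObstacle, hv, segment_eq_image']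
  constructor
  · rintro ⟨t, ⟨ht0, ht1⟩, rfl⟩
    refine ⟨(2 * t - 1) * (L / 2), ?_, ?_⟩
    · rw [abs_le]; constructor <;> nlinarith
    · simp only [Complex.real_smul]
      push_cast
      linear_combination hq
  · rintro ⟨τ, hτ, rfl⟩
    obtain ⟨h1, h2⟩ := abs_le.mp hτ
    -- The segment parameter τ / L + 1 / 2 is only meaningful for L > 0.
    rcases hL.eq_or_lt with rfl | hL
    · have : τ = 0 := by linarith
      subst this
      refine ⟨0, by simp, ?_⟩
      nth_rw 1 [hq]
      simp
    · refine ⟨τ / L + 1 / 2, ⟨?_, ?_⟩, ?_⟩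
      · rw [← sub_nonneg]
        have : τ / L + 1 / 2 - 0 = (τ + L / 2) / L := by field_simp; ring
        rw [this]; apply div_nonneg <;> linarith
      · rw [← sub_nonneg]
        have : 1 - (τ / L + 1 / 2) = (L / 2 - τ) / L := by field_simp; ring
        rw [this]; apply div_nonneg <;> linarith
      · simp only [Complex.real_smul]
        have : (τ / L * L : ℂ) = τ := div_mul_cancel₀ _ (by exact_mod_cast hL.ne')
        push_cast
        linear_combination hq + Complex.I * polarPoint 1 q.arg * this

/-- In the frame of q the obstacle lies on the line Re = |q|. With D + iC = q·conj p, the point s·p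
is on that line for s = |q|²/D, at offset -|q|C/D from the midpoint. Then s ≤ 1 and |offset| ≤ L/2
are the two conditions of `shadowGerms`. -/
lemma disjoint_facingObstacle_iff {L : ℝ} (hL : 0 ≤ L) (p q : ℂ) :
    Disjoint (segment ℝ 0 p) (facingObstacle L q) ↔ q ∉ shadowGerms L p := by
  set u := polarPoint 1 q.arg with hu
  have huu : u * star u = 1 := by rw [hu, polarPoint_mul_star]; simp [polarPoint]
  have hq : q = ‖q‖ * u := by
    conv_lhs => rw [← polarPoint_norm_arg q]
    simp [polarPoint, hu]
  have hseg : segment ℝ 0 p = (fun s : ℝ => (s : ℂ) * p) '' Set.Icc 0 1 := by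
    rw [segment_eq_image']; simp
  rw [← not_iff_not, not_not, Set.not_disjoint_iff, hseg]
  symm
  constructor
  · intro hmem
    -- An obstacle with germ 0 contains the origin, hence blocks every point.
    rcases eq_or_ne q 0 with h0 | h0
    · refine ⟨0, ⟨0, by simp, by simp⟩, (mem_facingObstacle_iff hL _ _).mpr ⟨0, ?_, ?_⟩⟩
      · simp; linarith
      · simp [h0]
    · have hn : 0 < ‖q‖ := norm_pos_iff.mpr h0
      obtain ⟨h1, h2⟩ := hmem
      set D := (q * star p).re with hD
      set C := (q * star p).im with hC
      have hD0 : 0 < D := lt_of_lt_of_le (by positivity) h1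
      have hp : ‖q‖ * p = (D - C * Complex.I) * u := by
        have h3 : star (q * star p) * u = ‖q‖ * p := by
          nth_rw 1 [hq]
          simp only [star_mul', star_star]
          have : star (‖q‖ : ℂ) = ‖q‖ := Complex.conj_ofReal _
          rw [this]
          linear_combination (‖q‖ : ℂ) * p * huu
        rw [← h3]
        congr 1
        apply Complex.ext <;> simp [hD, hC, add_comm]
      refine ⟨(‖q‖ ^ 2 / D : ℝ) * p, ⟨_, ⟨by positivity, (div_le_one hD0).mpr h1⟩, rfl⟩,
        (mem_facingObstacle_iff hL _ _).mpr ⟨-(‖q‖ * C / D), ?_, ?_⟩⟩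
      · rw [abs_neg, abs_div, abs_mul, abs_of_pos hn, abs_of_pos hD0, div_le_iff₀ hD0]
        exact h2
      · have hDc : (D : ℂ) ≠ 0 := by exact_mod_cast hD0.ne'
        rw [← hu]
        push_cast
        field_simp
        linear_combination (‖q‖ : ℂ) * hp
  · rintro ⟨z, ⟨s, ⟨hs0, hs1⟩, rfl⟩, hz⟩
    obtain ⟨τ, hτ, hz⟩ := (mem_facingObstacle_iff hL _ _).mp hz
    simp only at hz
    rw [← hu] at hz
    have key : (s : ℂ) * (q * star p) = ‖q‖ * (‖q‖ - τ * Complex.I) := by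
      have h3 : star ((s : ℂ) * p) = (‖q‖ - τ * Complex.I) * star u := by
        rw [hz]; simp [sub_eq_add_neg]
      have h4 : (s : ℂ) * star p = (‖q‖ - τ * Complex.I) * star u := by
        rw [← h3]; simp
      nth_rw 1 [hq]
      linear_combination ‖q‖ * u * h4 + ‖q‖ * (‖q‖ - τ * Complex.I) * huu
    have hre : s * (q * star p).re = ‖q‖ ^ 2 := by
      have := congrArg Complex.re key
      rw [Complex.re_ofReal_mul, Complex.re_ofReal_mul] at this
      rw [this]; simp [pow_two]
    have him : s * (q * star p).im = -(‖q‖ * τ) := by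
      have := congrArg Complex.im key
      rw [Complex.im_ofReal_mul, Complex.im_ofReal_mul] at this
      rw [this]; simp
    rcases hs0.eq_or_lt with rfl | hs
    · have : q = 0 := by simpa using hre.symm
      rw [this]; exact zero_mem_shadowGerms L p
    · have hD : 0 ≤ (q * star p).re := by
        by_contra h
        push Not at h
        nlinarith [sq_nonneg ‖q‖]
      refine ⟨by nlinarith, ?_⟩
      have h5 : s * |(q * star p).im| = ‖q‖ * |τ| := by
        rw [← abs_norm q, ← abs_mul, ← abs_neg (‖q‖ * τ), ← him, abs_mul, abs_of_pos hs]
      refine le_of_mul_le_mul_left ?_ hs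
      calc s * (‖q‖ * |(q * star p).im|) = ‖q‖ ^ 2 * |τ| := by rw [mul_left_comm, h5]; ring
        _ ≤ ‖q‖ ^ 2 * (L / 2) := by gcongr
        _ = s * (L / 2 * (q * star p).re) := by rw [← hre]; ring

lemma visibleFromOrigin_iff {L : ℝ} (hL : 0 ≤ L) (G : Set ℂ) (p : ℂ) :
    VisibleFromOrigin L G p ↔ G ∩ shadowGerms L p = ∅ := by
  simp only [VisibleFromOrigin, disjoint_facingObstacle_iff hL, ← Set.disjoint_iff_inter_eq_empty,
    Set.disjoint_left]

/-! ### Closedness and compactness -/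

lemma isClosed_setOf_mem_shadowGerms (L : ℝ) :
    IsClosed {x : ℂ × ℂ | x.2 ∈ shadowGerms L x.1} := by
  simp only [shadowGerms, Set.ofPred_and]
  exact (isClosed_le (by fun_prop) (by fun_prop)).inter (isClosed_le (by fun_prop) (by fun_prop))

lemma isClosed_shadowGerms (L : ℝ) (p : ℂ) : IsClosed (shadowGerms L p) :=
  (isClosed_setOf_mem_shadowGerms L).preimage (by fun_prop : Continuous fun q : ℂ => (p, q))

lemma isBounded_shadowGerms (L : ℝ) (p : ℂ) : Bornology.IsBounded (shadowGerms L p) :=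
  Metric.isBounded_closedBall.subset
    fun _ hq => mem_closedBall_zero_iff.mpr (norm_le_of_mem_shadowGerms hq)

lemma isCompact_biUnion_shadowGerms (L : ℝ) {K : Set ℂ} (hK : IsCompact K) :
    IsCompact (⋃ p ∈ K, shadowGerms L p) := by
  obtain ⟨M, hM⟩ := hK.isBounded.subset_closedBall 0
  have h : (⋃ p ∈ K, shadowGerms L p) =
      Prod.snd '' ((K ×ˢ Metric.closedBall (0 : ℂ) M) ∩ {x | x.2 ∈ shadowGerms L x.1}) := by
    ext q
    simp only [Set.mem_iUnion, Set.mem_image, Set.mem_inter_iff, Set.mem_prod, Set.mem_ofPred_eq,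
      Prod.exists, exists_prop, exists_eq_right]
    refine exists_congr fun p => ⟨fun h => ⟨⟨h.1, ?_⟩, h.2⟩, fun h => ⟨h.1.1, h.2⟩⟩
    exact mem_closedBall_zero_iff.mpr
      ((norm_le_of_mem_shadowGerms h.2).trans (mem_closedBall_zero_iff.mp (hM h.1)))
  rw [h]
  exact ((hK.prod (isCompact_closedBall 0 M)).inter_right
    (isClosed_setOf_mem_shadowGerms L)).image continuous_snd

/-! ### Area of the blocking region -/

lemma volume_shadowGerms_eq (L r φ : ℝ) :
    volume (shadowGerms L (polarPoint r φ)) = volume (shadowGerms L (r : ℂ)) := by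
  have h := ((rotation (Circle.exp φ)).measurePreserving).measure_preimage
    (isClosed_shadowGerms L (polarPoint r φ)).measurableSet.nullMeasurableSet
  rw [← h]
  congr 1
  ext q
  have hu : (Circle.exp φ : ℂ) * star (polarPoint r φ) = r := by
    have : (Circle.exp φ : ℂ) = polarPoint 1 φ := by simp [polarPoint, Circle.coe_exp]
    rw [this, polarPoint_mul_star]; simp [polarPoint]
  have h2 : rotation (Circle.exp φ) q * star (polarPoint r φ) = q * star (r : ℂ) := by
    rw [rotation_apply, mul_right_comm, hu, mul_comm]; simp
  simp only [Set.mem_preimage, shadowGerms, Set.mem_ofPred_eq, h2, LinearIsometryEquiv.norm_map]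

lemma mem_shadow_slice_iff {L r ρ β : ℝ} (hρ : 0 < ρ) (hρr : ρ ≤ r)
    (hβ : |β| < Real.pi) :
    (ρ ≤ r * Real.cos β ∧ ρ * |Real.sin β| ≤ L / 2 * Real.cos β) ↔
      |β| ≤ min (Real.arctan (L / (2 * ρ))) (Real.arccos (ρ / r)) := by
  have hr : 0 < r := hρ.trans_le hρr
  rw [le_min_iff, and_comm, ← Real.cos_abs, Real.abs_sin_eq_sin_abs_of_abs_le_pi hβ.le]
  rcases lt_or_ge |β| (Real.pi / 2) with h | h
  · have h0 : -(Real.pi / 2) < |β| := by linarith [abs_nonneg β, Real.pi_pos]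
    have hc : 0 < Real.cos |β| := Real.cos_pos_of_mem_Ioo ⟨h0, h⟩
    refine and_congr ?_ ?_
    · conv_rhs => rw [← Real.arctan_tan h0 h, Real.arctan_le_arctan_iff, Real.tan_eq_sin_div_cos,
        div_le_div_iff₀ hc (by positivity)]
      constructor <;> intro h <;> linarith
    · conv_rhs => rw [← Real.arccos_cos (abs_nonneg β) hβ.le]
      rw [Real.strictAntiOn_arccos.le_iff_ge ⟨Real.neg_one_le_cos _, Real.cos_le_one _⟩
        ⟨by linarith [div_pos hρ hr], (div_le_one hr).mpr hρr⟩, div_le_iff₀ hr, mul_comm]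
  -- Both sides fail here: the left needs a positive cosine, and the arctangent stays below π/2.
  · have hc : Real.cos |β| ≤ 0 :=
      Real.cos_nonpos_of_pi_div_two_le_of_le h (by linarith [Real.pi_pos])
    constructor
    · rintro ⟨-, h1⟩
      nlinarith
    · rintro ⟨h1, -⟩
      linarith [Real.arctan_lt_pi_div_two (L / (2 * ρ))]

/-- The slice at radius ρ ≤ r is the arc [-m, m], with m < π so that it fits in the polar chart;
beyond r it is empty. -/
lemma lintegral_shadow_slice {L r ρ : ℝ} (hL : 0 ≤ L) (hr : 0 ≤ r) (hρ : 0 < ρ) :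
    ∫⁻ β in Set.Ioo (-Real.pi) Real.pi,
      ENNReal.ofReal ρ * (shadowGerms L (r : ℂ)).indicator 1 (polarPoint ρ β) =
    (Set.Iic r).indicator (fun ρ => ENNReal.ofReal
      (2 * (ρ * min (Real.arctan (L / (2 * ρ))) (Real.arccos (ρ / r))))) ρ := by
  have hr0 : (r : ℂ) = polarPoint r 0 := by simp [polarPoint]
  rcases le_or_gt ρ r with hρr | hρr
  · set m := min (Real.arctan (L / (2 * ρ))) (Real.arccos (ρ / r)) with hm
    have hmpi : m < Real.pi := by
      have := Real.arctan_lt_pi_div_two (L / (2 * ρ))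
      have := min_le_left (Real.arctan (L / (2 * ρ))) (Real.arccos (ρ / r))
      linarith [Real.pi_pos]
    have hm0 : 0 ≤ m := le_min (Real.arctan_nonneg.mpr (by positivity)) (Real.arccos_nonneg _)
    have h : ∀ β ∈ Set.Ioo (-Real.pi) Real.pi,
        ENNReal.ofReal ρ * (shadowGerms L (r : ℂ)).indicator 1 (polarPoint ρ β) =
          (Set.Icc (-m) m).indicator (fun _ => ENNReal.ofReal ρ) β := by
      intro β hβ
      have : polarPoint ρ β ∈ shadowGerms L (r : ℂ) ↔ β ∈ Set.Icc (-m) m := by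
        rw [hr0, polarPoint_mem_shadowGerms_iff hρ (hρ.trans_le hρr), sub_zero,
          mem_shadow_slice_iff hρ hρr (abs_lt.mpr hβ), Set.mem_Icc, abs_le]
      by_cases hmem : β ∈ Set.Icc (-m) m
      · rw [Set.indicator_of_mem hmem, Set.indicator_of_mem (this.mpr hmem)]; simp
      · rw [Set.indicator_of_notMem hmem, Set.indicator_of_notMem (mt this.mp hmem), mul_zero]
    rw [setLIntegral_congr_fun measurableSet_Ioo h, setLIntegral_indicator measurableSet_Icc,
      Set.inter_eq_left.mpr (Set.Icc_subset_Ioo (by linarith) hmpi), setLIntegral_const,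
      Real.volume_Icc, Set.indicator_of_mem (Set.mem_Iic.mpr hρr), ← ENNReal.ofReal_mul hρ.le]
    congr 1
    ring
  · rw [Set.indicator_of_notMem (by simpa using hρr)]
    refine (lintegral_congr fun β => ?_).trans lintegral_zero
    rw [Set.indicator_of_notMem, mul_zero]
    intro h
    have := norm_le_of_mem_shadowGerms h
    rw [norm_polarPoint hρ.le, hr0, norm_polarPoint hr] at this
    linarith

lemma continuous_polarPoint : Continuous fun x : ℝ × ℝ => polarPoint x.1 x.2 := by
  unfold polarPoint
  fun_prop

lemma integrableOn_shadow_profile (L r : ℝ) :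
    IntegrableOn (fun ρ => ρ * min (Real.arctan (L / (2 * ρ))) (Real.arccos (ρ / r)))
      (Set.Ioc 0 r) := by
  have hmeas : Measurable
      fun ρ => ρ * min (Real.arctan (L / (2 * ρ))) (Real.arccos (ρ / r)) := by
    refine measurable_id.mul (Measurable.min ?_ ?_)
    · exact Real.measurable_arctan.comp (by fun_prop)
    · exact Real.continuous_arccos.measurable.comp (by fun_prop)
  refine Measure.integrableOn_of_bounded (M := r * Real.pi) (by simp) hmeas.aestronglyMeasurable ?_
  refine (ae_restrict_mem measurableSet_Ioc).mono fun ρ hρ => ?_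
  rw [norm_mul, Real.norm_of_nonneg hρ.1.le]
  refine mul_le_mul hρ.2 ?_ (norm_nonneg _) (hρ.1.le.trans hρ.2)
  rw [Real.norm_eq_abs, abs_le]
  have h1 := Real.neg_pi_div_two_lt_arctan (L / (2 * ρ))
  refine ⟨le_min (by linarith [Real.pi_pos]) ?_, (min_le_right _ _).trans (Real.arccos_le_pi _)⟩
  linarith [Real.pi_pos, Real.arccos_nonneg (ρ / r)]

lemma volume_shadowGerms {L r : ℝ} (hL : 0 ≤ L) (hr : 0 ≤ r) :
    volume (shadowGerms L (r : ℂ)) = ENNReal.ofReal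
      (2 * ∫ ρ in (0 : ℝ)..r,
        ρ * min (Real.arctan (L / (2 * ρ))) (Real.arccos (ρ / r))) := by
  have hS : MeasurableSet (shadowGerms L (r : ℂ)) := (isClosed_shadowGerms L _).measurableSet
  have hmeas : Measurable fun x : ℝ × ℝ =>
      ENNReal.ofReal x.1 * (shadowGerms L (r : ℂ)).indicator 1 (polarPoint x.1 x.2) :=
    (by fun_prop : Measurable fun x : ℝ × ℝ => ENNReal.ofReal x.1).mul
      ((measurable_one.indicator hS).comp continuous_polarPoint.measurable)
  rw [← lintegral_indicator_one hS, ← Complex.lintegral_comp_polarCoord_symm]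
  simp only [Complex.polarCoord_symm_apply, ← polarPoint_eq_cos_add_sin, smul_eq_mul,
    polarCoord_target]
  rw [Measure.volume_eq_prod, ← Measure.prod_restrict, lintegral_prod _ hmeas.aemeasurable,
    setLIntegral_congr_fun measurableSet_Ioi fun ρ hρ => lintegral_shadow_slice hL hr hρ,
    setLIntegral_indicator measurableSet_Iic, Set.inter_comm, Set.Ioi_inter_Iic,
    intervalIntegral.integral_of_le hr, ← integral_const_mul,
    ofReal_integral_eq_lintegral_ofReal ((integrableOn_shadow_profile L r).const_mul 2)]
  refine (ae_restrict_mem measurableSet_Ioc).mono fun ρ hρ => ?_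
  have := hρ.1
  exact mul_nonneg zero_le_two (mul_nonneg hρ.1.le
    (le_min (Real.arctan_nonneg.mpr (by positivity)) (Real.arccos_nonneg _)))

/-! ### Void probabilities and joint measurability -/

lemma IsHomogeneousPPP.setOf_inter_eq_empty {Ω : Type*} [MeasurableSpace Ω] {μ : Measure Ω}
    {lam0 : ℝ≥0} {Φ : Ω → Set ℂ} (hΦ : IsHomogeneousPPP μ lam0 Φ) {B : Set ℂ}
    (hbdd : Bornology.IsBounded B) :
    {ω | Φ ω ∩ B = ∅} = (fun ω => (Φ ω ∩ B).ncard) ⁻¹' {0} := by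
  ext ω
  -- `ncard` is also 0 on infinite sets; local finiteness excludes them.
  exact (Set.ncard_eq_zero (hΦ.locallyFinite ω B hbdd)).symm

lemma IsHomogeneousPPP.measurableSet_inter_eq_empty {Ω : Type*} [MeasurableSpace Ω]
    {μ : Measure Ω} {lam0 : ℝ≥0} {Φ : Ω → Set ℂ} (hΦ : IsHomogeneousPPP μ lam0 Φ) {B : Set ℂ}
    (hB : MeasurableSet B) (hbdd : Bornology.IsBounded B) :
    MeasurableSet {ω | Φ ω ∩ B = ∅} := by
  rw [hΦ.setOf_inter_eq_empty hbdd]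
  exact hΦ.measurable_count B hB hbdd (measurableSet_singleton 0)

lemma IsHomogeneousPPP.measure_inter_eq_empty {Ω : Type*} [MeasurableSpace Ω]
    {μ : Measure Ω} {lam0 : ℝ≥0} {Φ : Ω → Set ℂ} (hΦ : IsHomogeneousPPP μ lam0 Φ) {B : Set ℂ}
    (hB : MeasurableSet B) (hbdd : Bornology.IsBounded B) :
    μ {ω | Φ ω ∩ B = ∅} = ENNReal.ofReal (Real.exp (-(lam0 : ℝ) * (volume B).toReal)) := by
  rw [hΦ.setOf_inter_eq_empty hbdd,
    ← Measure.map_apply (hΦ.measurable_count B hB hbdd) (measurableSet_singleton 0),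
    hΦ.map_count B hB hbdd, poissonMeasure_singleton]
  simp [ENNReal.coe_toNNReal_eq_toReal]

/-- Only finitely many germs can block points within distance 1 of p, and each blocks a closed set
of points, so visibility persists near p. -/
lemma IsHomogeneousPPP.exists_ball_inter_eq_empty {Ω : Type*} [MeasurableSpace Ω]
    {μ : Measure Ω} {lam0 : ℝ≥0} {Φ : Ω → Set ℂ} (hΦ : IsHomogeneousPPP μ lam0 Φ) (L : ℝ) {ω : Ω}
    {p : ℂ} (hp : Φ ω ∩ shadowGerms L p = ∅) :
    ∃ ε > 0, Φ ω ∩ ⋃ p' ∈ Metric.ball p ε, shadowGerms L p' = ∅ := by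
  set T := Φ ω ∩ ⋃ p' ∈ Metric.closedBall p 1, shadowGerms L p' with hT
  have hTfin : T.Finite := hΦ.locallyFinite ω _
    (isCompact_biUnion_shadowGerms L (isCompact_closedBall p 1)).isBounded
  have hclosed : IsClosed (⋃ q ∈ T, {p' | q ∈ shadowGerms L p'}) :=
    hTfin.isClosed_biUnion fun q _ => (isClosed_setOf_mem_shadowGerms L).preimage
      (by fun_prop : Continuous fun p' : ℂ => (p', q))
  have hpn : p ∉ ⋃ q ∈ T, {p' | q ∈ shadowGerms L p'} := by
    simp only [Set.mem_iUnion, exists_prop, not_exists, not_and]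
    exact fun q hq hqp => Set.eq_empty_iff_forall_notMem.mp hp q ⟨hq.1, hqp⟩
  obtain ⟨ε, hε, hball⟩ := Metric.isOpen_iff.mp hclosed.isOpen_compl p hpn
  refine ⟨min ε 1, by positivity, Set.eq_empty_iff_forall_notMem.mpr ?_⟩
  rintro q ⟨hqΦ, hq⟩
  obtain ⟨p', hp', hqp'⟩ := Set.mem_iUnion₂.mp hq
  have hqT : q ∈ T := ⟨hqΦ, Set.mem_biUnion
    (Metric.ball_subset_closedBall (Metric.ball_subset_ball (min_le_right _ _) hp')) hqp'⟩
  exact hball (Metric.ball_subset_ball (min_le_left _ _) hp') (Set.mem_biUnion hqT hqp')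

/-- Visibility being an open condition, the set is a countable union of rectangles over small balls
K. The event that all of K is visible is a void event for one compact set, hence measurable. -/
lemma IsHomogeneousPPP.measurableSet_visible {Ω : Type*} [MeasurableSpace Ω]
    {μ : Measure Ω} {lam0 : ℝ≥0} {Φ : Ω → Set ℂ} (hΦ : IsHomogeneousPPP μ lam0 Φ) (L : ℝ) :
    MeasurableSet {x : Ω × ℂ | Φ x.1 ∩ shadowGerms L x.2 = ∅} := by
  let K : ℕ × ℕ → Set ℂ := fun n =>
    Metric.closedBall (TopologicalSpace.denseSeq ℂ n.1) (1 / ((n.2 : ℝ) + 1))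
  have h : {x : Ω × ℂ | Φ x.1 ∩ shadowGerms L x.2 = ∅} =
      ⋃ n, {ω | Φ ω ∩ ⋃ p ∈ K n, shadowGerms L p = ∅} ×ˢ K n := by
    ext ⟨ω, p⟩
    simp only [Set.mem_ofPred_eq, Set.mem_iUnion, Set.mem_prod]
    constructor
    · intro hp
      obtain ⟨ε, hε, hempty⟩ := hΦ.exists_ball_inter_eq_empty L hp
      obtain ⟨m, hm⟩ := exists_nat_one_div_lt (half_pos hε)
      obtain ⟨n, hn⟩ := (TopologicalSpace.denseRange_denseSeq ℂ).exists_dist_lt p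
        (Nat.one_div_pos_of_nat (n := m) (α := ℝ))
      refine ⟨(n, m), Set.eq_empty_of_subset_empty (hempty ▸ ?_), hn.le⟩
      refine Set.inter_subset_inter_right _ (Set.biUnion_subset_biUnion_left fun x hx => ?_)
      have hx : dist x (TopologicalSpace.denseSeq ℂ n) ≤ 1 / ((m : ℝ) + 1) := hx
      rw [Metric.mem_ball]
      calc dist x p ≤ dist x (TopologicalSpace.denseSeq ℂ n) +
            dist p (TopologicalSpace.denseSeq ℂ n) := dist_triangle_right _ _ _
        _ < ε := by linarith
    · rintro ⟨n, hempty, hp⟩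
      refine Set.eq_empty_of_subset_empty (hempty ▸ ?_)
      exact Set.inter_subset_inter_right _ (Set.subset_biUnion_of_mem hp)
  rw [h]
  refine MeasurableSet.iUnion fun n => ?_
  have hc := isCompact_biUnion_shadowGerms L (isCompact_closedBall
    (TopologicalSpace.denseSeq ℂ n.1) (1 / ((n.2 : ℝ) + 1)))
  exact (hΦ.measurableSet_inter_eq_empty hc.isClosed.measurableSet hc.isBounded).prod
    Metric.isClosed_closedBall.measurableSet

/-! ### Radial integration and the theorem -/

lemma setIntegral_closedBall_eq_of_radial {g : ℂ → ℝ} {h : ℝ → ℝ} {R : ℝ} (hR : 0 ≤ R)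
    (hg : ∀ r θ, 0 ≤ r → g (polarPoint r θ) = h r) :
    ∫ p in Metric.closedBall (0 : ℂ) R, g p = 2 * Real.pi * ∫ r in (0 : ℝ)..R, h r * r := by
  rw [← integral_indicator Metric.isClosed_closedBall.measurableSet,
    ← Complex.integral_comp_polarCoord_symm]
  simp only [Complex.polarCoord_symm_apply, ← polarPoint_eq_cos_add_sin, smul_eq_mul,
    polarCoord_target]
  have hind : ∀ x ∈ Set.Ioi (0 : ℝ) ×ˢ Set.Ioo (-Real.pi) Real.pi,
      x.1 * (Metric.closedBall (0 : ℂ) R).indicator g (polarPoint x.1 x.2) =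
        (Set.Iic R).indicator (fun r => h r * r) x.1 * (fun _ : ℝ => (1 : ℝ)) x.2 := by
    rintro ⟨r, θ⟩ ⟨hr, -⟩
    have hr : 0 < r := hr
    have hmem : polarPoint r θ ∈ Metric.closedBall (0 : ℂ) R ↔ r ∈ Set.Iic R := by
      rw [mem_closedBall_zero_iff, norm_polarPoint hr.le, Set.mem_Iic]
    by_cases hrR : r ∈ Set.Iic R
    · simp only [Set.indicator_of_mem hrR, Set.indicator_of_mem (hmem.mpr hrR), hg r θ hr.le]
      ring
    · simp only [Set.indicator_of_notMem hrR, Set.indicator_of_notMem (mt hmem.mp hrR)]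
      ring
  rw [setIntegral_congr_fun (measurableSet_Ioi.prod measurableSet_Ioo) hind,
    Measure.volume_eq_prod, setIntegral_prod_mul ((Set.Iic R).indicator fun r => h r * r)
      (fun _ : ℝ => (1 : ℝ)), setIntegral_indicator measurableSet_Iic,
    Set.Ioi_inter_Iic, intervalIntegral.integral_of_le hR, mul_comm]
  congr 1
  simp only [integral_const, smul_eq_mul, mul_one, measureReal_restrict_apply_univ]
  rw [Real.volume_real_Ioo_of_le (by linarith [Real.pi_pos])]
  ring

theorem lemma2 {Ω : Type*} [MeasurableSpace Ω] (μ : Measure Ω) [IsProbabilityMeasure μ]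
    (lam0 : ℝ≥0) (L R : ℝ) (hL : 0 ≤ L) (hR : 0 ≤ R)
    (Φ : Ω → Set ℂ) (hΦ : IsHomogeneousPPP μ lam0 Φ) :
    Integrable (fun ω => visibleArea L R (Φ ω)) μ ∧
    (∀ φ : ℝ, ∫ ω, visibleArea L R (Φ ω) ∂μ =
      2 * Real.pi * ∫ r in (0 : ℝ)..R,
        Real.exp (-(lam0 : ℝ) * (volume (blockingRegion L r φ)).toReal) * r) ∧
    (∀ r φ : ℝ, 0 ≤ r → r ≤ R →
      volume (blockingRegion L r φ) = ENNReal.ofReal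
        (2 * ∫ ρ in (0 : ℝ)..r,
          ρ * min (Real.arctan (L / (2 * ρ))) (Real.arccos (ρ / r)))) := by
  set V : Set (Ω × ℂ) :=
    {x | x.2 ∈ Metric.closedBall (0 : ℂ) R} ∩ {x | Φ x.1 ∩ shadowGerms L x.2 = ∅} with hV
  have hVm : MeasurableSet V :=
    (measurable_snd Metric.isClosed_closedBall.measurableSet).inter (hΦ.measurableSet_visible L)
  have hslice : ∀ ω, visibleRegion L R (Φ ω) = Prod.mk ω ⁻¹' V := by
    intro ω
    ext p
    exact and_congr_right fun _ => visibleFromOrigin_iff hL (Φ ω) p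
  have hle : ∀ ω, volume (visibleRegion L R (Φ ω)) ≤ volume (Metric.closedBall (0 : ℂ) R) :=
    fun ω => measure_mono fun p hp => hp.1
  have hfin : volume (Metric.closedBall (0 : ℂ) R) < ⊤ := measure_closedBall_lt_top
  have hmeas : Measurable fun ω => volume (visibleRegion L R (Φ ω)) := by
    simp only [hslice]
    exact measurable_measure_prodMk_left hVm
  have hshadow : Measurable fun p : ℂ => volume (shadowGerms L p) :=
    measurable_measure_prodMk_left (isClosed_setOf_mem_shadowGerms L).measurableSet
  refine ⟨?_, fun φ => ?_, fun r φ hr _ => ?_⟩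
  · refine Integrable.of_bound hmeas.ennreal_toReal.aestronglyMeasurable
      (volume (Metric.closedBall (0 : ℂ) R)).toReal (Filter.Eventually.of_forall fun ω => ?_)
    rw [visibleArea, Real.norm_of_nonneg ENNReal.toReal_nonneg]
    exact ENNReal.toReal_mono hfin.ne (hle ω)
  · have hμ : ∀ p, μ ((fun ω => (ω, p)) ⁻¹' V) = (Metric.closedBall (0 : ℂ) R).indicator
        (fun p => ENNReal.ofReal
          (Real.exp (-(lam0 : ℝ) * (volume (shadowGerms L p)).toReal))) p := by
      intro p
      by_cases hp : p ∈ Metric.closedBall (0 : ℂ) R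
      · rw [Set.indicator_of_mem hp, ← hΦ.measure_inter_eq_empty
          (isClosed_shadowGerms L p).measurableSet (isBounded_shadowGerms L p)]
        congr 1
        ext ω
        exact and_iff_right hp
      · rw [Set.indicator_of_notMem hp]
        convert measure_empty (μ := μ)
        exact Set.eq_empty_of_forall_notMem fun ω hω => hp hω.1
    calc ∫ ω, visibleArea L R (Φ ω) ∂μ
        = (∫⁻ ω, volume (visibleRegion L R (Φ ω)) ∂μ).toReal :=
          integral_toReal hmeas.aemeasurable
            (Filter.Eventually.of_forall fun ω => (hle ω).trans_lt hfin)
      _ = (∫⁻ p in Metric.closedBall (0 : ℂ) R, ENNReal.ofReal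
            (Real.exp (-(lam0 : ℝ) * (volume (shadowGerms L p)).toReal))).toReal := by
          -- Tonelli: the integrals of the ω-slices and of the p-slices both give the product
          -- measure of `V`.
          simp only [hslice]
          rw [← Measure.prod_apply hVm, Measure.prod_apply_symm hVm, lintegral_congr hμ,
            lintegral_indicator Metric.isClosed_closedBall.measurableSet]
      _ = ∫ p in Metric.closedBall (0 : ℂ) R,
            Real.exp (-(lam0 : ℝ) * (volume (shadowGerms L p)).toReal) := by
          rw [integral_eq_lintegral_of_nonneg_ae
            (Filter.Eventually.of_forall fun p => (Real.exp_pos _).le)]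
          exact (Real.measurable_exp.comp
            (hshadow.ennreal_toReal.const_mul _)).aestronglyMeasurable
      _ = 2 * Real.pi * ∫ r in (0 : ℝ)..R,
            Real.exp (-(lam0 : ℝ) * (volume (shadowGerms L (r : ℂ))).toReal) * r :=
          setIntegral_closedBall_eq_of_radial hR fun r θ _ => by rw [volume_shadowGerms_eq]
      _ = _ := by
          congr 1
          refine intervalIntegral.integral_congr fun r hr => ?_
          rw [Set.uIcc_of_le hR] at hr
          -- Rotation invariance removes φ, so every direction gives the same integrand.
          simp only [blockingRegion_eq_shadowGerms hL hr.1, volume_shadowGerms_eq]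
  · rw [blockingRegion_eq_shadowGerms hL hr, volume_shadowGerms_eq, volume_shadowGerms hL hr]
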